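/- Let $\overline{\mathbb{Q}}$ be the field of algebraic numbers, let $h_{\mathbb{P}^N}$ denote the absolute logarithmic Weil height on $\mathbb{P}^N(\overline{\mathbb{Q}})$, that is, $h_{\mathbb{P}^N}([x_0:\dots:x_N])=\sum_{v\in M_K}\frac{[K_v:\mathbb{Q}_v]}{[K:\mathbb{Q}]}\log\max_i|x_i|_v$ for any number field $K$ containing $x_0,\dots,x_N$, and write $h_{\mathbb{P}^2}(\lambda_0,\lambda_\infty)=h_{\mathbb{P}^2}([1:\lambda_0:\lambda_\infty])$. For a rational function $f\in\overline{\mathbb{Q}}(z)$ of degree $d\geq 2$, let $\hat{h}_f(P)=\lim_{n\to\infty}d^{-n}h_{\mathbb{P}^1}(f^n(P))$ be its canonical height, where $f^n$ is the $n$-th iterate, and let \[\hat{h}_{\mathrm{crit}}(f)=\sum_{P\in\mathbb{P}^1(\overline{\mathbb{Q}})}(e_P(f)-1)\,\hat{h}_f(P)\] be its critical height, where $e_P(f)$ is the ramification index of $f$ at $P$. Then for all $\lambda_0,\lambda_\infty\in\overline{\mathbb{Q}}$ with $\lambda_0\lambda_\infty\neq 1$, the quadratic map \[f_{\lambda_0,\lambda_\infty}(z)=\frac{\lambda_0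 z+z^2}{\lambda_\infty z+1}\] satisfies \[\hat{h}_{\mathrm{crit}}\left(f_{\lambda_0,\lambda_\infty}\right)\geq\frac{1}{2048}\,h_{\mathbb{P}^2}(\lambda_0,\lambda_\infty)-0.012.\] -/

import Mathlib

open Filter Topology Polynomial

noncomputable section

/-- The field of algebraic numbers. -/
abbrev QBar : Type := AlgebraicClosure ℚ

instance : Algebra.IsAlgebraic ℚ QBar := AlgebraicClosure.isAlgebraic ℚ

/-! ### Absolute logarithmic Weil height -/

/-- The field generated over `ℚ` by the coordinates of a tuple of algebraic numbers. -/
abbrev coordField {ι : Type*} (x : ι → QBar) : IntermediateField ℚ QBar :=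
  IntermediateField.adjoin ℚ (Set.range x)

theorem numberField_coordField {ι : Type*} [Finite ι] (x : ι → QBar) :
    NumberField (coordField x) := by
  have : FiniteDimensional ℚ (coordField x) :=
    IntermediateField.finiteDimensional_adjoin
      (fun y _ => (Algebra.IsAlgebraic.isAlgebraic (R := ℚ) y).isIntegral)
  exact {}

/-- The coordinates of `x`, regarded as elements of the number field they generate. -/
def coordTuple {ι : Type*} (x : ι → QBar) (i : ι) : coordField x :=
  ⟨x i, IntermediateField.subset_adjoin ℚ (Set.range x) (Set.mem_range_self i)⟩

/-- The absolute logarithmic Weil height of the point of projective space over `QBar` with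
homogeneous coordinates `x`: the sum over the places `v` of the number field `K` generated by the
coordinates of `([K_v : ℚ_v] / [K : ℚ]) * log max_i |x i|_v`. -/
def absLogHeight {ι : Type*} [Finite ι] (x : ι → QBar) : ℝ :=
  haveI : NumberField (coordField x) := numberField_coordField x
  Height.logHeight (coordTuple x) / (Module.finrank ℚ (coordField x) : ℝ)

/-- The Weil height on the projective line `QBar ∪ {∞}`. -/
def heightP1 (P : OnePoint QBar) : ℝ :=
  P.elim (absLogHeight ![(1 : QBar), 0]) (fun z => absLogHeight ![z, 1])

/-! ### Rational functions as self-maps of the projective line -/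

section RationalMaps

variable {K : Type*} [Field K]

/-- The degree of a rational function as a self-map of the projective line. -/
def ratDegree (f : RatFunc K) : ℕ :=
  max f.num.natDegree f.denom.natDegree

open Classical in
/-- The self-map of the projective line `K ∪ {∞}` induced by a rational function. -/
def ratMap (f : RatFunc K) (P : OnePoint K) : OnePoint K :=
  P.elim
    (if f.denom.coeff (ratDegree f) = 0 then OnePoint.infty
      else ((f.num.coeff (ratDegree f) / f.denom.coeff (ratDegree f) : K) : OnePoint K))
    (fun z => if f.denom.eval z = 0 then OnePoint.infty
      else ((f.num.eval z / f.denom.eval z : K) : OnePoint K))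

/-- The polynomial whose zeros, as a form of degree `ratDegree f` on the projective line, are the
points of the fibre of `f` over `Q`, with multiplicity. -/
def fiberPoly (f : RatFunc K) (Q : OnePoint K) : K[X] :=
  Q.elim f.denom (fun w => f.num - C w * f.denom)

/-- The ramification index `e_P(f)`: the multiplicity of `P` in the fibre of `f` over `f(P)`. -/
def ramificationIndex (f : RatFunc K) (P : OnePoint K) : ℕ :=
  P.elim (ratDegree f - (fiberPoly f (ratMap f P)).natDegree)
    (fun z => (fiberPoly f (ratMap f P)).rootMultiplicity z)

end RationalMaps

/-! ### Canonical height and critical height -/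

/-- The canonical height `lim_n h(f^n(P)) / d^n`, where `d` is the degree of `f` (for `d ≥ 2`). -/
def canonicalHeight (f : RatFunc QBar) (P : OnePoint QBar) : ℝ :=
  limUnder atTop (fun n : ℕ => heightP1 ((ratMap f)^[n] P) / (ratDegree f : ℝ) ^ n)

/-- The critical height: the sum over all points of `(e_P(f) - 1)` times the canonical height. -/
def criticalHeight (f : RatFunc QBar) : ℝ :=
  ∑ᶠ P : OnePoint QBar, ((ramificationIndex f P : ℝ) - 1) * canonicalHeight f P

/-- The rational function `(l₀ z + z²) / (l₁ z + 1)`. -/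
def quadraticMap (l₀ l₁ : QBar) : RatFunc QBar :=
  (RatFunc.C l₀ * RatFunc.X + RatFunc.X ^ 2) / (RatFunc.C l₁ * RatFunc.X + 1)

end

/-! Write `a`, `b` for `λ₀`, `λ_∞`; they are the multipliers of `f` at its fixed points `0` and `∞`.
The critical points are the zeros of `b z² + 2 z + a`, and `f(c) = -c²` at each of them. Factoring
the critical form with `p`, `q` as homogeneous critical points (`IsCriticalPair`), the products `p.1
* q.2` and `q.1 * p.2` sum to `-2`, so at no place are both small. Hence at each place the critical
points can be labelled so that one is drawn to `0` whenever `|a|` is small and the other to `∞`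
whenever `|b|` is small. After `n + 1` steps the first has size at most `(κ|a|)^(n+2)`, and likewise
for the reciprocal of the second with `b` (`IsCriticalPair.local_bound`).

Summing over all places, with `h(1/a) = h(a)`, bounds `(n + 2)(h(a) + h(b))` by twice the sum of the
heights of the two `(n+1)`-st critical iterates, plus `O(n)` (`IsCriticalPair.mul_logHeight_le`).
Conversely, a resultant identity and telescoping give `h(f^m(c)) ≤ 2^m ĥ(c) + 2 h(a, b) + log 4`
with an error independent of `m` (`canonicalHeight_bounds`). The left side of the first bound grows
linearly in `n`, so a suitable `n` beats this error. The choice `n = 11` yields the stated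
constants. -/

noncomputable section

/-! ### Comparing heights of tuples place by place -/

namespace Height

open AdmissibleAbsValues Function

variable {K : Type*} [Field K] [AdmissibleAbsValues K] {ι ι' : Type*}

theorem hasFiniteMulSupport_iSup_nonarch [Finite ι] {x : ι → K} (hx : x ≠ 0) :
    (fun v : nonarchAbsVal (K := K) ↦ ⨆ i, v.val (x i)).HasFiniteMulSupport := by
  have : Nonempty {j // x j ≠ 0} := nonempty_subtype.mpr <| ne_iff.mp hx
  suffices (fun v : nonarchAbsVal (K := K) ↦
      ⨆ i : {j // x j ≠ 0}, v.val (x i)).HasFiniteMulSupport by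
    convert! this with v
    obtain ⟨i, hi⟩ : ∃ j, x j ≠ 0 := Function.ne_iff.mp hx
    have : Nonempty ι := .intro i
    refine le_antisymm (ciSup_le fun j ↦ ?_) (ciSup_le fun ⟨j, hj⟩ ↦ Finite.le_ciSup_of_le j le_rfl)
    rcases eq_or_ne (x j) 0 with h | h
    · rw [h, v.val.map_zero]
      exact Real.iSup_nonneg' ⟨⟨i, hi⟩, v.val.nonneg ..⟩
    · exact Finite.le_ciSup_of_le ⟨j, h⟩ le_rfl
  fun_prop (disch := grind)

/-- A comparison of the maxima of two tuples at every place, up to a constant at the archimedean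
places, gives a comparison of their heights. -/
theorem logHeight_le_of_forall_iSup_le [Finite ι] [Finite ι'] {x : ι → K} {y : ι' → K}
    (hx : x ≠ 0) (hy : y ≠ 0) {C : ℝ} (hC : 0 < C)
    (harch : ∀ v ∈ archAbsVal (K := K), ⨆ i, v (x i) ≤ C * ⨆ j, v (y j))
    (hnon : ∀ v ∈ nonarchAbsVal (K := K), ⨆ i, v (x i) ≤ ⨆ j, v (y j)) :
    logHeight x ≤ totalWeight K * Real.log C + logHeight y := by
  have key : mulHeight x ≤ C ^ totalWeight K * mulHeight y := by
    rw [mulHeight_eq hx, mulHeight_eq hy, ← mul_assoc]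
    gcongr
    · exact finprod_nonneg fun v ↦ Real.iSup_nonneg_of_nonnegHomClass v.val _
    · exact mul_nonneg (by positivity)
        (Multiset.prod_map_nonneg fun v _ ↦ Real.iSup_nonneg_of_nonnegHomClass v _)
    · rw [← Multiset.prod_replicate, totalWeight, ← Multiset.map_const', ← Multiset.prod_map_mul]
      exact Multiset.prod_map_le_prod_map₀ _ _
        (fun v _ ↦ Real.iSup_nonneg_of_nonnegHomClass v _) harch
    · exact finprod_le_finprod (hasFiniteMulSupport_iSup_nonarch hx)
        (fun v ↦ Real.iSup_nonneg_of_nonnegHomClass v.val _)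
        (hasFiniteMulSupport_iSup_nonarch hy) fun v ↦ hnon v v.2
  rw [logHeight_eq_log_mulHeight, logHeight_eq_log_mulHeight, ← Real.log_pow,
    ← Real.log_mul (by positivity) (mulHeight_ne_zero y)]
  exact Real.log_le_log (mulHeight_pos x) key

end Height

/-! ### Invariance of heights under extension of the base field -/

namespace NumberField

variable {K L : Type*} [Field K] [NumberField K] [Field L] [NumberField L]

/-- `mult` counts the embeddings inducing a place, so the weights disappear. Embeddings restrict to
subfields more simply than places do. -/
theorem prod_infinitePlace_pow_mult_eq (f : (K → ℝ) → ℝ) :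
    ∏ v : InfinitePlace K, f v ^ v.mult = ∏ φ : K →+* ℂ, f (fun x ↦ ‖φ x‖) := by
  classical
  rw [← Finset.prod_fiberwise Finset.univ InfinitePlace.mk]
  refine Finset.prod_congr rfl fun w _ ↦ ?_
  rw [← InfinitePlace.card_filter_mk_eq, ← Finset.prod_const]
  refine Finset.prod_congr rfl fun φ hφ ↦ ?_
  rw [← (Finset.mem_filter.mp hφ).2]
  rfl

theorem prod_embeddings_comp_algebraMap [Algebra K L] (g : (K →+* ℂ) → ℝ) :
    ∏ φ : L →+* ℂ, g (φ.comp (algebraMap K L)) = (∏ φ : K →+* ℂ, g φ) ^ Module.finrank K L := by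
  classical
  rw [← Finset.prod_fiberwise Finset.univ (fun φ : L →+* ℂ ↦ φ.comp (algebraMap K L)),
    ← Finset.prod_pow]
  refine Finset.prod_congr rfl fun ψ _ ↦ ?_
  rw [Finset.prod_congr rfl (g := fun _ ↦ g ψ)
    (fun φ hφ ↦ by rw [(Finset.mem_filter.mp hφ).2]), Finset.prod_const]
  congr 1
  -- The fibre over `ψ` is the set of `K`-algebra maps `L → ℂ`, with `ℂ` a `K`-algebra through `ψ`;
  -- there are `[L : K]` of them.
  let _ : Algebra K ℂ := ψ.toAlgebra
  have : FiniteDimensional K L := Module.Finite.of_restrictScalars_finite ℚ K L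
  rw [← AlgHom.card K L ℂ, ← Fintype.card_subtype]
  refine Fintype.card_congr
    { toFun := fun φ ↦ { φ.1 with commutes' := fun r ↦ RingHom.congr_fun φ.2 r }
      invFun := fun φ ↦ ⟨φ.toRingHom, φ.comp_algebraMap⟩
      left_inv := fun _ ↦ rfl
      right_inv := fun _ ↦ rfl }

theorem mulHeight_of_integral {ι : Type*} [Finite ι] {x : ι → 𝓞 K} (hx : x ≠ 0) :
    Height.mulHeight (fun i ↦ (x i : K)) =
      (∏ φ : K →+* ℂ, ⨆ i, ‖φ (x i)‖) / (Ideal.span (Set.range x)).absNorm := by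
  have hx' : (fun i ↦ (x i : K)) ≠ 0 := by
    contrapose! hx
    ext i
    simpa using congr_fun hx i
  have h := absNorm_mul_finprod_finitePlace_eq_one hx
  have h0 : ((Ideal.span (Set.range x)).absNorm : ℝ) ≠ 0 := left_ne_zero_of_mul_eq_one h
  rw [mulHeight_eq hx', eq_div_iff h0, mul_assoc, mul_comm (finprod _), h, mul_one]
  exact prod_infinitePlace_pow_mult_eq (K := K) fun u ↦ ⨆ i, u (x i : K)

/-- After clearing denominators, the finite places contribute the inverse norm of the ideal of
coordinates. That norm is raised to the power `[L : K]` by extension, as is the product over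
embeddings, so no splitting of primes has to be analysed. -/
theorem mulHeight_algebraMap [Algebra K L] {ι : Type*} [Finite ι] (x : ι → K) :
    Height.mulHeight (fun i ↦ algebraMap K L (x i)) =
      Height.mulHeight x ^ Module.finrank K L := by
  classical
  rcases eq_or_ne x 0 with rfl | hx
  · simp
  obtain ⟨d, hd⟩ := IsLocalization.exist_integer_multiples_of_finite
    (nonZeroDivisors (𝓞 K)) x
  choose y hy using hd
  have hd0 : ((d : 𝓞 K) : K) ≠ 0 := by simp
  have hyx : (fun i ↦ (y i : K)) = ((d : 𝓞 K) : K) • x := by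
    ext i
    rw [RingOfIntegers.coe_eq_algebraMap, hy i]
    rfl
  have hy0 : y ≠ 0 := by
    rintro rfl
    have : ((d : 𝓞 K) : K) • x = 0 := by rw [← hyx]; ext i; simp
    simp_all
  let z : ι → 𝓞 L := fun i ↦ algebraMap (𝓞 K) (𝓞 L) (y i)
  have hzy (i : ι) : (z i : L) = algebraMap K L (y i) := rfl
  have hz0 : z ≠ 0 := by
    obtain ⟨i, hi⟩ := Function.ne_iff.mp hy0
    refine Function.ne_iff.mpr ⟨i, ?_⟩
    simpa [z] using hi
  have hzx : (fun i ↦ (z i : L)) = algebraMap K L (d : 𝓞 K) • fun i ↦ algebraMap K L (x i) := by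
    ext i
    rw [hzy, congr_fun hyx i]
    simp
  rw [← Height.mulHeight_smul_eq_mulHeight _ (c := algebraMap K L (d : 𝓞 K)) (by simp), ← hzx,
    ← Height.mulHeight_smul_eq_mulHeight x hd0, ← hyx, mulHeight_of_integral hz0,
    mulHeight_of_integral hy0, div_pow]
  congr 1
  · rw [← prod_embeddings_comp_algebraMap]
    rfl
  · have : Ideal.span (Set.range z) = (Ideal.span (Set.range y)).map (algebraMap (𝓞 K) (𝓞 L)) := by
      rw [Ideal.map_span, ← Set.range_comp]
      rfl
    rw [this, Ideal.absNorm_algebraMap]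
    push_cast
    congr 1
    exact (IsFractionRing.finrank_eq (𝓞 K) K (𝓞 L) L).symm

end NumberField

theorem absLogHeight_coe {ι : Type*} [Finite ι] (L : IntermediateField ℚ QBar) [NumberField L]
    (y : ι → L) :
    absLogHeight (fun i ↦ (y i : QBar)) = Height.logHeight y / Module.finrank ℚ L := by
  set x : ι → QBar := fun i ↦ (y i : QBar) with hx
  have hle : coordField x ≤ L := by
    rw [IntermediateField.adjoin_le_iff]
    rintro _ ⟨i, rfl⟩
    exact (y i).2
  have : NumberField (coordField x) := numberField_coordField x
  let _ : Algebra (coordField x) L := (IntermediateField.inclusion hle).toAlgebra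
  have : IsScalarTower ℚ (coordField x) L :=
    IsScalarTower.of_algebraMap_eq' (IntermediateField.inclusion hle).comp_algebraMap.symm
  have hy : y = fun i ↦ algebraMap (coordField x) L (coordTuple x i) := rfl
  have hfin := Module.finrank_mul_finrank ℚ (coordField x) L
  have hpos : 0 < Module.finrank ℚ L := Module.finrank_pos
  rw [← hfin] at hpos
  have h1 : (Module.finrank ℚ (coordField x) : ℝ) ≠ 0 := by
    exact_mod_cast (pos_of_mul_pos_left hpos (Nat.zero_le _)).ne'
  have h2 : (Module.finrank (coordField x) L : ℝ) ≠ 0 := by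
    exact_mod_cast (pos_of_mul_pos_right hpos (Nat.zero_le _)).ne'
  rw [hy, Height.logHeight_eq_log_mulHeight, NumberField.mulHeight_algebraMap, Real.log_pow,
    ← Height.logHeight_eq_log_mulHeight, ← hfin]
  unfold absLogHeight
  push_cast
  field_simp

/-! ### The quadratic map in homogeneous coordinates -/

section Homogeneous

variable {K : Type*} [Field K]

/-- The lift of `z ↦ (a z + z²) / (b z + 1)` to homogeneous coordinates. -/
def quadLift (a b : K) (p : K × K) : K × K :=
  (p.1 * (p.1 + a * p.2), p.2 * (b * p.1 + p.2))

theorem quadLift_swap (a b : K) (p : K × K) : quadLift b a p.swap = (quadLift a b p).swap := by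
  ext <;> simp [quadLift, add_comm]

theorem quadLift_iterate_swap (a b : K) (p : K × K) (n : ℕ) :
    (quadLift b a)^[n] p.swap = ((quadLift a b)^[n] p).swap := by
  induction n with
  | zero => rfl
  | succ n ih => rw [Function.iterate_succ_apply', ih, quadLift_swap, Function.iterate_succ_apply']

/-- `1 - a b` is the resultant of the two forms of `quadLift`. These identities bound `p` by its
image, which gives both nonvanishing and the lower height estimate. -/
theorem resultant_mul_fst_pow (a b : K) (p : K × K) :
    (1 - a * b) * p.1 ^ 3 = (quadLift a b p).1 * ((1 - a * b) * p.1 - a * p.2) +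
      a ^ 2 * p.1 * (quadLift a b p).2 := by
  simp only [quadLift]; ring

theorem resultant_mul_snd_pow (a b : K) (p : K × K) :
    (1 - a * b) * p.2 ^ 3 = (quadLift a b p).2 * ((1 - a * b) * p.2 - b * p.1) +
      b ^ 2 * p.2 * (quadLift a b p).1 := by
  simp only [quadLift]; ring

theorem quadLift_ne_zero {a b : K} (hab : a * b ≠ 1) {p : K × K} (hp : p ≠ 0) :
    quadLift a b p ≠ 0 := by
  contrapose! hp
  have hr : (1 - a * b) ≠ 0 := sub_ne_zero.mpr hab.symm
  have h1 := resultant_mul_fst_pow a b p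
  have h2 := resultant_mul_snd_pow a b p
  simp only [hp, Prod.fst_zero, Prod.snd_zero, zero_mul, mul_zero, add_zero, mul_eq_zero, hr,
    false_or, pow_eq_zero_iff three_ne_zero] at h1 h2
  exact Prod.ext h1 h2

theorem quadLift_iterate_ne_zero {a b : K} (hab : a * b ≠ 1) {p : K × K} (hp : p ≠ 0) (n : ℕ) :
    (quadLift a b)^[n] p ≠ 0 := by
  induction n with
  | zero => exact hp
  | succ n ih => rw [Function.iterate_succ_apply']; exact quadLift_ne_zero hab ih

end Homogeneous

section LocalMax

variable {K : Type*} [Field K]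

theorem iSup_abv_two (v : AbsoluteValue K ℝ) (a b : K) :
    ⨆ i, v (![a, b] i) = max (v a) (v b) := by
  refine le_antisymm (ciSup_le fun i ↦ ?_) (max_le ?_ ?_)
  · fin_cases i <;> simp
  · exact Finite.le_ciSup_of_le 0 (by simp)
  · exact Finite.le_ciSup_of_le 1 (by simp)

theorem iSup_abv_three (v : AbsoluteValue K ℝ) (a b c : K) :
    ⨆ i, v (![a, b, c] i) = max (v a) (max (v b) (v c)) := by
  refine le_antisymm (ciSup_le fun i ↦ ?_) (max_le ?_ (max_le ?_ ?_))
  · fin_cases i <;> simp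
  · exact Finite.le_ciSup_of_le 0 (by simp)
  · exact Finite.le_ciSup_of_le 1 (by simp)
  · exact Finite.le_ciSup_of_le 2 (by simp)

theorem pair_vec_ne_zero {p : K × K} (hp : p ≠ 0) : ![p.1, p.2] ≠ 0 := by
  contrapose! hp
  exact Prod.ext (congr_fun hp 0) (congr_fun hp 1)

theorem one_vec_ne_zero (a b : K) : ![1, a, b] ≠ 0 := fun h ↦ one_ne_zero (congr_fun h 0)

end LocalMax

/-! ### Height distortion under one application of the map. -/

section HeightBounds

open Height Height.AdmissibleAbsValues

variable {K : Type*} [Field K] [AdmissibleAbsValues K]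

/-- The (relative) logarithmic height of a point of the projective line. -/
def pairHeight (p : K × K) : ℝ := logHeight ![p.1, p.2]

theorem pairHeight_quadLift_le {a b : K} (hab : a * b ≠ 1) {p : K × K} (hp : p ≠ 0) :
    pairHeight (quadLift a b p) ≤
      2 * pairHeight p + logHeight ![1, a, b] + totalWeight K * Real.log 2 := by
  have hp' := pair_vec_ne_zero hp
  have hl := one_vec_ne_zero a b
  have hpp : (fun i : Fin 2 × Fin 2 ↦ ![p.1, p.2] i.1 * ![p.1, p.2] i.2) ≠ 0 := by
    obtain ⟨i, hi⟩ := Function.ne_iff.mp hp'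
    exact Function.ne_iff.mpr ⟨(i, i), mul_ne_zero hi hi⟩
  have hppl : (fun i : (Fin 2 × Fin 2) × Fin 3 ↦
      (![p.1, p.2] i.1.1 * ![p.1, p.2] i.1.2) * ![1, a, b] i.2) ≠ 0 := by
    obtain ⟨i, hi⟩ := Function.ne_iff.mp hpp
    obtain ⟨j, hj⟩ := Function.ne_iff.mp hl
    exact Function.ne_iff.mpr ⟨(i, j), mul_ne_zero hi hj⟩
  -- Segre device: a tuple of all products has local maximum the product of the maxima, so a sum of
  -- heights becomes the height of a single tuple.
  have hloc (v : AbsoluteValue K ℝ) : ⨆ i : (Fin 2 × Fin 2) × Fin 3,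
      v ((![p.1, p.2] i.1.1 * ![p.1, p.2] i.1.2) * ![1, a, b] i.2) =
      (max (v p.1) (v p.2) * max (v p.1) (v p.2)) * max 1 (max (v a) (v b)) := by
    rw [← iSup_abv_two, ← v.map_one, ← iSup_abv_three,
      ← Real.iSup_fun_mul_eq_iSup_mul_iSup_of_nonneg v,
      ← Real.iSup_fun_mul_eq_iSup_mul_iSup_of_nonneg v]
  have main := logHeight_le_of_forall_iSup_le (C := 2)
    (pair_vec_ne_zero (quadLift_ne_zero hab hp)) hppl two_pos
    (fun v _ ↦ by
      rw [hloc, iSup_abv_two]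
      simp only [quadLift, map_mul]
      have ha : v a ≤ max 1 (max (v a) (v b)) := by simp
      have hb : v b ≤ max 1 (max (v a) (v b)) := by simp
      have h1 : 1 ≤ max 1 (max (v a) (v b)) := by simp
      have hx : v p.1 ≤ max (v p.1) (v p.2) := by simp
      have hy : v p.2 ≤ max (v p.1) (v p.2) := by simp
      generalize max 1 (max (v a) (v b)) = M at *
      generalize max (v p.1) (v p.2) = P at *
      have hP : 0 ≤ P := (v.nonneg _).trans hx
      have e1 : v (p.1 + a * p.2) ≤ 2 * (P * M) := by
        refine (v.add_le _ _).trans ?_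
        rw [v.map_mul]
        nlinarith [mul_le_mul ha hy (v.nonneg _) (by linarith), mul_le_mul_of_nonneg_left h1 hP]
      have e2 : v (b * p.1 + p.2) ≤ 2 * (P * M) := by
        refine (v.add_le _ _).trans ?_
        rw [v.map_mul]
        nlinarith [mul_le_mul hb hx (v.nonneg _) (by linarith), mul_le_mul_of_nonneg_left h1 hP]
      refine max_le ?_ ?_
      · refine (mul_le_mul hx e1 (v.nonneg _) hP).trans (le_of_eq (by ring))
      · refine (mul_le_mul hy e2 (v.nonneg _) hP).trans (le_of_eq (by ring)))
    (fun v hv ↦ by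
      rw [hloc, iSup_abv_two]
      simp only [quadLift, map_mul]
      have ha : v a ≤ max 1 (max (v a) (v b)) := by simp
      have hb : v b ≤ max 1 (max (v a) (v b)) := by simp
      have h1 : 1 ≤ max 1 (max (v a) (v b)) := by simp
      have hx : v p.1 ≤ max (v p.1) (v p.2) := by simp
      have hy : v p.2 ≤ max (v p.1) (v p.2) := by simp
      generalize max 1 (max (v a) (v b)) = M at *
      generalize max (v p.1) (v p.2) = P at *
      have hP : 0 ≤ P := (v.nonneg _).trans hx
      have e1 : v (p.1 + a * p.2) ≤ P * M := by
        refine (isNonarchimedean v hv _ _).trans (max_le ?_ ?_)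
        · exact hx.trans (le_mul_of_one_le_right hP h1)
        · rw [v.map_mul, mul_comm P]
          exact mul_le_mul ha hy (v.nonneg _) (by linarith)
      have e2 : v (b * p.1 + p.2) ≤ P * M := by
        refine (isNonarchimedean v hv _ _).trans (max_le ?_ ?_)
        · rw [v.map_mul, mul_comm P]
          exact mul_le_mul hb hx (v.nonneg _) (by linarith)
        · exact hy.trans (le_mul_of_one_le_right hP h1)
      refine max_le ?_ ?_
      · refine (mul_le_mul hx e1 (v.nonneg _) hP).trans (le_of_eq (by ring))
      · refine (mul_le_mul hy e2 (v.nonneg _) hP).trans (le_of_eq (by ring)))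
  rw [logHeight_fun_mul_eq hpp hl, logHeight_fun_mul_eq hp' hp'] at main
  unfold pairHeight
  linarith

/-- The resultant identities bound `3 h(p)` by `h(f(p)) + h(p)` plus the error; the factor `1 - a b`
is a common scalar and costs nothing by the product formula. -/
theorem two_mul_pairHeight_le {a b : K} (hab : a * b ≠ 1) {p : K × K} (hp : p ≠ 0) :
    2 * pairHeight p ≤
      pairHeight (quadLift a b p) + 2 * logHeight ![1, a, b] + totalWeight K * Real.log 4 := by
  set q := quadLift a b p with hq
  have hp' := pair_vec_ne_zero hp
  have hq' := pair_vec_ne_zero (quadLift_ne_zero hab hp)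
  rw [← hq] at hq'
  have hl := one_vec_ne_zero a b
  have hr : 1 - a * b ≠ 0 := sub_ne_zero.mpr hab.symm
  have hqp : (fun i : Fin 2 × Fin 2 ↦ ![q.1, q.2] i.1 * ![p.1, p.2] i.2) ≠ 0 := by
    obtain ⟨i, hi⟩ := Function.ne_iff.mp hq'
    obtain ⟨j, hj⟩ := Function.ne_iff.mp hp'
    exact Function.ne_iff.mpr ⟨(i, j), mul_ne_zero hi hj⟩
  have hll : (fun i : Fin 3 × Fin 3 ↦ ![1, a, b] i.1 * ![1, a, b] i.2) ≠ 0 := by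
    obtain ⟨i, hi⟩ := Function.ne_iff.mp hl
    exact Function.ne_iff.mpr ⟨(i, i), mul_ne_zero hi hi⟩
  have hall : (fun i : (Fin 2 × Fin 2) × (Fin 3 × Fin 3) ↦
      (![q.1, q.2] i.1.1 * ![p.1, p.2] i.1.2) * (![1, a, b] i.2.1 * ![1, a, b] i.2.2)) ≠ 0 := by
    obtain ⟨i, hi⟩ := Function.ne_iff.mp hqp
    obtain ⟨j, hj⟩ := Function.ne_iff.mp hll
    exact Function.ne_iff.mpr ⟨(i, j), mul_ne_zero hi hj⟩
  have hcube : (1 - a * b) • ![p.1, p.2] ^ 3 ≠ 0 := smul_ne_zero hr (pow_ne_zero 3 hp')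
  have hcube' : (1 - a * b) • ![p.1, p.2] ^ 3 =
      ![(1 - a * b) * p.1 ^ 3, (1 - a * b) * p.2 ^ 3] := by
    ext i; fin_cases i <;> simp
  have hloc (v : AbsoluteValue K ℝ) : ⨆ i : (Fin 2 × Fin 2) × (Fin 3 × Fin 3),
      v ((![q.1, q.2] i.1.1 * ![p.1, p.2] i.1.2) * (![1, a, b] i.2.1 * ![1, a, b] i.2.2)) =
      (max (v q.1) (v q.2) * max (v p.1) (v p.2)) *
        (max 1 (max (v a) (v b)) * max 1 (max (v a) (v b))) := by
    rw [← iSup_abv_two, ← iSup_abv_two, ← v.map_one, ← iSup_abv_three,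
      ← Real.iSup_fun_mul_eq_iSup_mul_iSup_of_nonneg v,
      ← Real.iSup_fun_mul_eq_iSup_mul_iSup_of_nonneg v,
      ← Real.iSup_fun_mul_eq_iSup_mul_iSup_of_nonneg v]
  have id1 := resultant_mul_fst_pow a b p
  have id2 := resultant_mul_snd_pow a b p
  rw [← hq] at id1 id2
  have main := logHeight_le_of_forall_iSup_le (C := 4) hcube hall four_pos
    (fun v _ ↦ by
      have hsub (s t : K) : v (s - t) ≤ v s + v t := by
        rw [sub_eq_add_neg, ← v.map_neg t]; exact v.add_le s (-t)
      rw [hloc, hcube', iSup_abv_two, id1, id2]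
      have ha : v a ≤ max 1 (max (v a) (v b)) := by simp
      have hb : v b ≤ max 1 (max (v a) (v b)) := by simp
      have h1 : 1 ≤ max 1 (max (v a) (v b)) := by simp
      have hx : v p.1 ≤ max (v p.1) (v p.2) := by simp
      have hy : v p.2 ≤ max (v p.1) (v p.2) := by simp
      have hx' : v q.1 ≤ max (v q.1) (v q.2) := by simp
      have hy' : v q.2 ≤ max (v q.1) (v q.2) := by simp
      generalize max 1 (max (v a) (v b)) = M at *
      generalize max (v p.1) (v p.2) = P at *
      generalize max (v q.1) (v q.2) = Q at *
      have hP : 0 ≤ P := (v.nonneg _).trans hx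
      have hQ : 0 ≤ Q := (v.nonneg _).trans hx'
      have hM : M ≤ M * M := le_mul_of_one_le_right (by linarith) h1
      have hr : v (1 - a * b) ≤ 2 * (M * M) := by
        refine (hsub _ _).trans ?_
        rw [v.map_one, v.map_mul]
        nlinarith [mul_le_mul ha hb (v.nonneg _) (by linarith)]
      have key (s t x y x' y' : K) (hs : v s ≤ M) (hx : v x ≤ P) (hy : v y ≤ P)
          (hx' : v x' ≤ Q) (hy' : v y' ≤ Q) :
          v (x' * ((1 - a * b) * x - s * y) + s ^ 2 * x * y') ≤ 4 * (Q * P * (M * M)) := by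
        have e1 : v ((1 - a * b) * x - s * y) ≤ 3 * (P * (M * M)) := by
          refine (hsub _ _).trans ?_
          rw [v.map_mul, v.map_mul]
          nlinarith [mul_le_mul hr hx (v.nonneg _) (by nlinarith),
            mul_le_mul (hs.trans hM) hy (v.nonneg _) (by nlinarith)]
        have e2 : v (s ^ 2 * x * y') ≤ Q * (P * (M * M)) := by
          rw [v.map_mul, v.map_mul, v.map_pow, mul_comm _ (v y'), pow_two, mul_comm _ (v x)]
          gcongr
        refine (v.add_le _ _).trans ?_
        rw [v.map_mul]
        nlinarith [mul_le_mul hx' e1 (v.nonneg _) hQ]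
      exact max_le (key a b _ _ _ _ ha hx hy hx' hy') (key b a _ _ _ _ hb hy hx hy' hx'))
    (fun v hv ↦ by
      have hna := isNonarchimedean v hv
      have hsub (s t : K) : v (s - t) ≤ max (v s) (v t) := by
        rw [sub_eq_add_neg, ← v.map_neg t]; exact hna s (-t)
      rw [hloc, hcube', iSup_abv_two, id1, id2]
      have ha : v a ≤ max 1 (max (v a) (v b)) := by simp
      have hb : v b ≤ max 1 (max (v a) (v b)) := by simp
      have h1 : 1 ≤ max 1 (max (v a) (v b)) := by simp
      have hx : v p.1 ≤ max (v p.1) (v p.2) := by simp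
      have hy : v p.2 ≤ max (v p.1) (v p.2) := by simp
      have hx' : v q.1 ≤ max (v q.1) (v q.2) := by simp
      have hy' : v q.2 ≤ max (v q.1) (v q.2) := by simp
      generalize max 1 (max (v a) (v b)) = M at *
      generalize max (v p.1) (v p.2) = P at *
      generalize max (v q.1) (v q.2) = Q at *
      have hP : 0 ≤ P := (v.nonneg _).trans hx
      have hQ : 0 ≤ Q := (v.nonneg _).trans hx'
      have hM : M ≤ M * M := le_mul_of_one_le_right (by linarith) h1
      have hr : v (1 - a * b) ≤ M * M := by
        refine (hsub _ _).trans (max_le ?_ ?_)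
        · rw [v.map_one]; linarith
        · rw [v.map_mul]; exact mul_le_mul ha hb (v.nonneg _) (by linarith)
      have key (s t x y x' y' : K) (hs : v s ≤ M) (hx : v x ≤ P) (hy : v y ≤ P)
          (hx' : v x' ≤ Q) (hy' : v y' ≤ Q) :
          v (x' * ((1 - a * b) * x - s * y) + s ^ 2 * x * y') ≤ Q * P * (M * M) := by
        have e1 : v ((1 - a * b) * x - s * y) ≤ P * (M * M) := by
          refine (hsub _ _).trans (max_le ?_ ?_) <;> rw [v.map_mul, mul_comm P]
          · exact mul_le_mul hr hx (v.nonneg _) (by nlinarith)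
          · exact mul_le_mul (hs.trans hM) hy (v.nonneg _) (by nlinarith)
        rw [mul_assoc Q]
        refine (hna _ _).trans (max_le ?_ ?_)
        · rw [v.map_mul]
          exact mul_le_mul hx' e1 (v.nonneg _) hQ
        · rw [v.map_mul, v.map_mul, v.map_pow, mul_comm _ (v y'), pow_two, mul_comm _ (v x)]
          gcongr
      exact max_le (key a b _ _ _ _ ha hx hy hx' hy') (key b a _ _ _ _ hb hy hx hy' hx'))
  rw [logHeight_smul_eq_logHeight _ hr, logHeight_pow, logHeight_fun_mul_eq hqp hll,
    logHeight_fun_mul_eq hq' hp', logHeight_fun_mul_eq hl hl] at main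
  unfold pairHeight
  push_cast at main
  linarith

end HeightBounds

/-! ### Local attraction of the critical points to the fixed points -/

section LocalAttraction

variable {K : Type*} [Field K]

/-- The point `p` lies in the region `|z| < |a|`, `|b z| ≤ |a|` near the fixed point `0`, and
satisfies `0 < |z| ≤ T`. -/
structure NearZero (v : AbsoluteValue K ℝ) (a b : K) (T : ℝ) (p : K × K) : Prop where
  fst_ne_zero : p.1 ≠ 0
  snd_ne_zero : p.2 ≠ 0
  lt : v p.1 < v a * v p.2
  le : v (b * p.1) ≤ v a * v p.2
  le_bound : v p.1 ≤ T * v p.2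

/-- The map `z ↦ (a z + z²) / (b z + 1)` contracts by a factor at most `κ |a|` near the
fixed point `0`. -/
def ContractsNearZero (v : AbsoluteValue K ℝ) (a b : K) (κ : ℝ) : Prop :=
  ∀ x y, y ≠ 0 → v x < v a * v y → v (b * x) ≤ v a * v y →
    0 < v (b * x + y) ∧ v (x + a * y) ≤ κ * v a * v (b * x + y)

/-- The contraction factor is below `1`, so the region is forward invariant. The strict bound `|z| <
|a|` excludes the zero `z = -a`, so the orbit never lands on `0`. -/
theorem NearZero.quadLift {v : AbsoluteValue K ℝ} {a b : K} {κ T : ℝ} {p : K × K}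
    (hκ : κ * v a < 1) (hc : ContractsNearZero v a b κ) (h : NearZero v a b T p) :
    NearZero v a b (κ * v a * T) (quadLift a b p) := by
  obtain ⟨x, y⟩ := p
  obtain ⟨hx, hy, hlt, hle, hT⟩ := h
  simp only at hx hy hlt hle hT
  obtain ⟨hpos, hbd⟩ := hc x y hy hlt hle
  have hcontr : v (x * (x + a * y)) ≤ κ * v a * (v x * v (b * x + y)) := by
    rw [v.map_mul]
    nlinarith [mul_le_mul_of_nonneg_left hbd (v.nonneg x)]
  have hone : v (x * (x + a * y)) ≤ v x * v (b * x + y) :=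
    hcontr.trans (mul_le_of_le_one_left (by positivity) hκ.le)
  have hκ0 : 0 ≤ κ * v a := by
    by_contra! hneg
    have : κ * v a * v (b * x + y) < 0 := mul_neg_of_neg_of_pos hneg hpos
    linarith [v.nonneg (x + a * y)]
  refine ⟨mul_ne_zero hx fun h0 ↦ ?_, mul_ne_zero hy (v.pos_iff.mp hpos), ?_, ?_, ?_⟩
  · replace h0 : x + a * y = 0 := h0
    rw [eq_neg_of_add_eq_zero_left h0, v.map_neg, v.map_mul] at hlt
    exact lt_irrefl _ hlt
  · refine hone.trans_lt ?_
    simp only [_root_.quadLift, v.map_mul]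
    rw [← mul_assoc]
    exact mul_lt_mul_of_pos_right hlt hpos
  · simp only [_root_.quadLift, v.map_mul] at hone hle ⊢
    calc v b * (v x * v (x + a * y)) ≤ v b * (v x * v (b * x + y)) := by gcongr
      _ = (v b * v x) * v (b * x + y) := by ring
      _ ≤ (v a * v y) * v (b * x + y) := by gcongr
      _ = _ := by ring
  · refine hcontr.trans ?_
    simp only [_root_.quadLift, v.map_mul]
    calc κ * v a * (v x * v (b * x + y)) ≤ κ * v a * ((T * v y) * v (b * x + y)) := by gcongr
      _ = _ := by ring

theorem NearZero.quadLift_iterate {v : AbsoluteValue K ℝ} {a b : K} {κ T : ℝ} {p : K × K}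
    (hκ : κ * v a < 1) (hc : ContractsNearZero v a b κ) (h : NearZero v a b T p) (n : ℕ) :
    NearZero v a b ((κ * v a) ^ n * T) ((_root_.quadLift a b)^[n] p) := by
  induction n with
  | zero => simpa using h
  | succ n ih =>
    rw [Function.iterate_succ_apply', pow_succ', mul_assoc (κ * v a)]
    exact ih.quadLift hκ hc

theorem contractsNearZero_of_four_mul_lt {v : AbsoluteValue K ℝ} {a : K} (b : K)
    (ha : 4 * v a < 1) : ContractsNearZero v a b 4 := by
  intro x y hy hlt hle
  have hy' := v.pos hy
  have h1 : v y ≤ v (b * x + y) + v (b * x) := by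
    have := v.add_le (b * x + y) (-(b * x))
    rwa [v.map_neg, add_comm (b * x) y, add_neg_cancel_right, add_comm y] at this
  have h2 : v (x + a * y) ≤ v x + v a * v y := by
    rw [← v.map_mul]; exact v.add_le _ _
  -- Thus `|b z + 1| ≥ 3/4` and `|z + a| ≤ 2|a|`; the ratio is at most `(8/3)|a|`, within `4|a|`.
  have h3 : v a * v y ≤ 1 / 4 * v y := by gcongr; linarith
  refine ⟨by linarith, ?_⟩
  have h4 : 3 / 4 * v y ≤ v (b * x + y) := by linarith
  have h5 : v a * (3 / 4 * v y) ≤ v a * v (b * x + y) := by gcongr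
  nlinarith [mul_nonneg (v.nonneg a) hy'.le]

theorem contractsNearZero_of_isNonarchimedean {v : AbsoluteValue K ℝ} (hv : IsNonarchimedean v)
    {a : K} (b : K) {κ : ℝ} (hκ : 1 ≤ κ) (ha : κ * v a < 1) : ContractsNearZero v a b κ := by
  intro x y hy hlt hle
  have hy' := v.pos hy
  have ha1 : v a < 1 := (le_mul_of_one_le_left (v.nonneg a) hκ).trans_lt ha
  have h1 : v (b * x) < v y := hle.trans_lt (mul_lt_of_lt_one_left hy' ha1)
  have h2 : v (b * x + y) = v y := by
    refine le_antisymm ((hv _ _).trans (max_le h1.le le_rfl)) ?_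
    have := hv (b * x + y) (-(b * x))
    rw [v.map_neg, add_comm (b * x) y, add_neg_cancel_right, add_comm y] at this
    rcases le_max_iff.mp this with h | h
    · exact h
    · exact absurd h h1.not_ge
  rw [h2]
  refine ⟨hy', (hv _ _).trans (max_le ?_ ?_)⟩
  · refine hlt.le.trans ?_
    gcongr
    exact le_mul_of_one_le_left (v.nonneg a) hκ
  · rw [v.map_mul]
    gcongr
    exact le_mul_of_one_le_left (v.nonneg a) hκ

/-- The critical form `b X² + 2 X Y + a Y²` of `z ↦ (a z + z²) / (b z + 1)` factors as
`(y₁ X - x₁ Y) (y₂ X - x₂ Y)`, where `p = (x₁, y₁)` and `q = (x₂, y₂)`. -/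
structure IsCriticalPair (a b : K) (p q : K × K) : Prop where
  fst_mul_fst : p.1 * q.1 = a
  snd_mul_snd : p.2 * q.2 = b
  add_eq : p.1 * q.2 + q.1 * p.2 = -2

theorem IsCriticalPair.symm {a b : K} {p q : K × K} (h : IsCriticalPair a b p q) :
    IsCriticalPair a b q p :=
  ⟨by rw [mul_comm, h.1], by rw [mul_comm, h.2], by rw [add_comm, h.3]⟩

theorem IsCriticalPair.swap {a b : K} {p q : K × K} (h : IsCriticalPair a b p q) :
    IsCriticalPair b a p.swap q.swap :=
  ⟨h.2, h.1, by simp only [Prod.fst_swap, Prod.snd_swap]; linear_combination h.3⟩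

/-- In affine terms `f(c) = -c²`, which turns the size of a critical point into that of its image.
The scalar is harmless because its square is the resultant. -/
theorem IsCriticalPair.quadLift_eq {a b : K} {p q : K × K} (h : IsCriticalPair a b p q) :
    quadLift a b p = (1 + q.1 * p.2) • (p.1 ^ 2, -p.2 ^ 2) := by
  obtain ⟨h1, h2, h3⟩ := h
  ext
  · simp only [quadLift, Prod.smul_mk, smul_eq_mul, ← h1]; ring
  · simp only [quadLift, Prod.smul_mk, smul_eq_mul, ← h2]
    linear_combination p.2 ^ 2 * h3

theorem IsCriticalPair.sq_eq {a b : K} {p q : K × K} (h : IsCriticalPair a b p q) :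
    (1 + q.1 * p.2) ^ 2 = 1 - a * b := by
  obtain ⟨h1, h2, h3⟩ := h
  rw [← h1, ← h2]
  linear_combination q.1 * p.2 * h3

/-- The critical point has size `|a| / |q.1 p.2| ≤ |a| / c ≤ κ|a|`, and its image is its square up
to sign. This is the origin of the exponent `2`. -/
theorem IsCriticalPair.nearZero {v : AbsoluteValue K ℝ} {a b : K} {p q : K × K} {κ c : ℝ}
    (h : IsCriticalPair a b p q) (hab : a * b ≠ 1) (ha : a ≠ 0) (hc : 0 < c) (hc1 : c ≤ 1)
    (hκc : 1 ≤ κ * c ^ 2) (hκ : κ * v a < 1) (hle : c ≤ v (q.1 * p.2))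
    (hmax : v (p.1 * q.2) ≤ v (q.1 * p.2)) :
    NearZero v a b ((κ * v a) ^ 2) (quadLift a b p) := by
  have hu : 1 + q.1 * p.2 ≠ 0 := by
    intro h0
    have := h.sq_eq
    rw [h0] at this
    exact hab (by linear_combination this)
  rw [h.quadLift_eq]
  obtain ⟨h1, h2, -⟩ := h
  subst h1 h2
  obtain ⟨x, y⟩ := p
  obtain ⟨x', y'⟩ := q
  simp only [mul_ne_zero_iff] at *
  have hqp : 0 < v (x' * y) := hc.trans_le hle
  have hy : y ≠ 0 := right_ne_zero_of_mul (v.pos_iff.mp hqp)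
  have hκ0 : 0 < κ := by
    by_contra! hn
    nlinarith [mul_nonneg (neg_nonneg.mpr hn) (sq_nonneg c)]
  have hx' := v.pos ha.2
  have hx := v.pos ha.1
  have hyp := v.pos hy
  have hup := v.pos hu
  simp only [v.map_mul] at *
  have hκ1 : 1 ≤ κ * (v x' * v y) ^ 2 := hκc.trans (by gcongr)
  refine ⟨mul_ne_zero hu (pow_ne_zero 2 ha.1), mul_ne_zero hu (neg_ne_zero.mpr (pow_ne_zero 2 hy)),
    ?_, ?_, ?_⟩ <;> simp only [Prod.smul_mk, smul_eq_mul, v.map_mul, v.map_neg, v.map_pow]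
  -- Multiplied by `|x'|`, this reads `|a| < |x' y|²`, which follows from `κ|a| < 1 ≤ κ|x' y|²`.
  · have : v x < v x' * v y ^ 2 := by
      by_contra! hcon
      have e1 : κ * (v x' * v y) ^ 2 ≤ κ * (v x * v x') := by
        have := mul_le_mul_of_nonneg_left hcon (mul_pos hκ0 hx').le
        nlinarith
      linarith
    calc v (1 + x' * y) * v x ^ 2 = v (1 + x' * y) * v x * v x := by ring
      _ < v (1 + x' * y) * v x * (v x' * v y ^ 2) := by gcongr
      _ = _ := by ring
  · calc v y * v y' * (v (1 + x' * y) * v x ^ 2)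
        = v (1 + x' * y) * v x * v y * (v x * v y') := by ring
      _ ≤ v (1 + x' * y) * v x * v y * (v x' * v y) := by gcongr
      _ = _ := by ring
  · have e1 : 1 ≤ κ * (v x' * v y) := by
      have h3 : c ^ 2 ≤ c := by nlinarith
      calc 1 ≤ κ * c ^ 2 := hκc
        _ ≤ κ * c := by gcongr
        _ ≤ _ := by gcongr
    have e2 : 1 ≤ (κ * (v x' * v y)) ^ 2 := one_le_pow₀ e1
    calc v (1 + x' * y) * v x ^ 2 = v (1 + x' * y) * v x ^ 2 * 1 := by ring
      _ ≤ v (1 + x' * y) * v x ^ 2 * (κ * (v x' * v y)) ^ 2 := by gcongr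
      _ = _ := by ring

/-- The affine coordinate of a point, with `0` and `∞` replaced by `1`. -/
def unitCoord (p : K × K) : K :=
  open Classical in if p.1 = 0 ∨ p.2 = 0 then 1 else p.1 / p.2

theorem unitCoord_ne_zero (p : K × K) : unitCoord p ≠ 0 := by
  unfold unitCoord
  split_ifs with h
  · exact one_ne_zero
  · push Not at h
    exact div_ne_zero h.1 h.2

theorem unitCoord_swap (p : K × K) : unitCoord p.swap = (unitCoord p)⁻¹ := by
  unfold unitCoord
  by_cases h1 : p.1 = 0 <;> by_cases h2 : p.2 = 0 <;> simp [h1, h2]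

theorem NearZero.le_unitCoord {v : AbsoluteValue K ℝ} {a b : K} {T : ℝ} {p : K × K}
    (h : NearZero v a b T p) : 1 ≤ T * v (unitCoord p)⁻¹ := by
  have h2 := h.le_bound
  rw [unitCoord, if_neg (by simp [h.1, h.2]), inv_div, map_div₀]
  have := v.pos h.1
  rw [← mul_div_assoc, le_div_iff₀ this, one_mul]
  exact h2

/-- If `|a⁻¹| ≤ κ` the factor `κ^(n+2)` suffices. Otherwise `p` is attracted to `0`: its image gives
exponent `2`, and each of the `n` further steps gives one more. -/
theorem IsCriticalPair.max_inv_pow_le {v : AbsoluteValue K ℝ} {a b : K} {p q : K × K} {κ c : ℝ}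
    (h : IsCriticalPair a b p q) (hab : a * b ≠ 1) (hc : 0 < c) (hc1 : c ≤ 1) (hκ1 : 1 ≤ κ)
    (hκc : 1 ≤ κ * c ^ 2) (hcon : κ * v a < 1 → ContractsNearZero v a b κ)
    (hle : c ≤ v (q.1 * p.2)) (hmax : v (p.1 * q.2) ≤ v (q.1 * p.2)) (n : ℕ) {G : ℝ} (hG1 : 1 ≤ G)
    (hG : v (unitCoord ((quadLift a b)^[n + 1] p))⁻¹ ≤ G) :
    max 1 (v a⁻¹) ^ (n + 2) ≤ κ ^ (n + 2) * G := by
  have hκn : 1 ≤ κ ^ (n + 2) := one_le_pow₀ hκ1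
  have hbase : κ ^ (n + 2) ≤ κ ^ (n + 2) * G := le_mul_of_one_le_right (by linarith) hG1
  rcases le_total (v a⁻¹) κ with h0 | h0
  · exact (pow_le_pow_left₀ (by positivity) (max_le hκ1 h0) _).trans hbase
  · rcases eq_or_ne a 0 with rfl | ha
    · simp only [inv_zero, map_zero] at h0
      linarith
    rcases eq_or_lt_of_le h0 with h0 | h0
    · exact (pow_le_pow_left₀ (by positivity) (max_le hκ1 h0.ge) _).trans hbase
    have hva := v.pos ha
    rw [map_inv₀, lt_inv_comm₀ (by linarith) hva] at h0
    have hκa : κ * v a < 1 := by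
      rwa [← lt_inv_mul_iff₀ (by linarith), mul_one]
    have hnear := (h.nearZero hab ha hc hc1 hκc hκa hle hmax).quadLift_iterate hκa (hcon hκa) n
    rw [← Function.iterate_succ_apply, ← pow_add] at hnear
    have h1 := hnear.le_unitCoord
    have h2 : 1 ≤ (κ * v a) ^ (n + 2) * G := h1.trans (by gcongr)
    have h3 : 1 ≤ v a⁻¹ := by
      rw [map_inv₀, one_le_inv₀ hva]
      nlinarith
    rw [max_eq_right h3, map_inv₀, inv_pow, inv_le_iff_one_le_mul₀ (by positivity)]
    rw [mul_pow] at h2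
    linarith

theorem IsCriticalPair.local_bound_aux {v : AbsoluteValue K ℝ} {a b : K} {p q : K × K} {κ c : ℝ}
    (h : IsCriticalPair a b p q) (hab : a * b ≠ 1) (hc : 0 < c) (hc1 : c ≤ 1) (hκ1 : 1 ≤ κ)
    (hκc : 1 ≤ κ * c ^ 2) (hcon : κ * v a < 1 → ContractsNearZero v a b κ)
    (hcon' : κ * v b < 1 → ContractsNearZero v b a κ)
    (hle : c ≤ v (q.1 * p.2)) (hmax : v (p.1 * q.2) ≤ v (q.1 * p.2)) (n : ℕ) :
    max 1 (v a⁻¹) ^ (n + 2) * max 1 (v b⁻¹) ^ (n + 2) ≤ κ ^ (2 * (n + 2)) *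
      (max (v (unitCoord ((quadLift a b)^[n + 1] p)))
          (v (unitCoord ((quadLift a b)^[n + 1] p))⁻¹) *
        max (v (unitCoord ((quadLift a b)^[n + 1] q)))
          (v (unitCoord ((quadLift a b)^[n + 1] q))⁻¹)) := by
  have hone (x : K) (hx : x ≠ 0) : 1 ≤ max (v x) (v x⁻¹) := by
    rcases le_total 1 (v x) with h | h
    · exact h.trans (le_max_left _ _)
    · refine le_trans ?_ (le_max_right _ _)
      rw [map_inv₀]
      exact (one_le_inv₀ (v.pos hx)).mpr h
  have e1 := h.max_inv_pow_le hab hc hc1 hκ1 hκc hcon hle hmax n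
    (hone _ (unitCoord_ne_zero _)) (le_max_right _ _)
  -- The conjugation `z ↦ 1/z` exchanges `a` with `b` and `0` with `∞`. Applied to `q`, it keeps the
  -- same dominant product.
  have e2 := h.symm.swap.max_inv_pow_le (by rwa [mul_comm]) hc hc1 hκ1 hκc hcon'
    (by simpa [mul_comm] using hle) (by simpa [mul_comm] using hmax) n
    (hone _ (unitCoord_ne_zero ((quadLift a b)^[n + 1] q)))
    (by rw [quadLift_iterate_swap, unitCoord_swap, inv_inv]; exact le_max_left _ _)
  refine (mul_le_mul e1 e2 (by positivity) (by positivity)).trans (le_of_eq ?_)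
  rw [two_mul (n + 2), pow_add]
  ring

theorem IsCriticalPair.local_bound {v : AbsoluteValue K ℝ} {a b : K} {p q : K × K} {κ c : ℝ}
    (h : IsCriticalPair a b p q) (hab : a * b ≠ 1) (hc : 0 < c) (hc1 : c ≤ 1) (hκ1 : 1 ≤ κ)
    (hκc : 1 ≤ κ * c ^ 2) (hcon : κ * v a < 1 → ContractsNearZero v a b κ)
    (hcon' : κ * v b < 1 → ContractsNearZero v b a κ)
    (hle : c ≤ max (v (p.1 * q.2)) (v (q.1 * p.2))) (n : ℕ) :
    max 1 (v a⁻¹) ^ (n + 2) * max 1 (v b⁻¹) ^ (n + 2) ≤ κ ^ (2 * (n + 2)) *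
      (max (v (unitCoord ((quadLift a b)^[n + 1] p)))
          (v (unitCoord ((quadLift a b)^[n + 1] p))⁻¹) *
        max (v (unitCoord ((quadLift a b)^[n + 1] q)))
          (v (unitCoord ((quadLift a b)^[n + 1] q))⁻¹)) := by
  rcases le_total (v (p.1 * q.2)) (v (q.1 * p.2)) with hm | hm
  · rw [max_eq_right hm] at hle
    exact h.local_bound_aux hab hc hc1 hκ1 hκc hcon hcon' hle hm n
  · rw [max_eq_left hm] at hle
    refine (h.symm.local_bound_aux hab hc hc1 hκ1 hκc hcon hcon' hle hm n).trans (le_of_eq ?_)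
    ring

end LocalAttraction

/-! ### Summing the local attraction bounds over all places. -/

section GlobalBound

open Height Height.AdmissibleAbsValues

variable {K : Type*} [Field K]

theorem abv_two_of_mem_archAbsVal [NumberField K] {v : AbsoluteValue K ℝ}
    (hv : v ∈ archAbsVal (K := K)) : v 2 = 2 := by
  obtain ⟨φ, rfl⟩ := NumberField.mem_multisetInfinitePlace.mp hv
  have : ‖φ (2 : K)‖ = 2 := by rw [map_ofNat]; norm_num
  exact this

theorem AbsoluteValue.iSup_pow {ι : Type*} [Finite ι] [Nonempty ι]
    (v : AbsoluteValue K ℝ) (x : ι → K) (n : ℕ) :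
    ⨆ i, v ((x ^ n) i) = (⨆ i, v (x i)) ^ n := by
  simp only [Pi.pow_apply, map_pow]
  refine le_antisymm (ciSup_le fun i ↦ ?_) ?_
  · gcongr
    exact Finite.le_ciSup_of_le i le_rfl
  · obtain ⟨i, hi⟩ := exists_eq_ciSup_of_finite (f := fun i ↦ v (x i))
    rw [← hi]
    exact Finite.le_ciSup_of_le i le_rfl

theorem logHeight_self_inv [AdmissibleAbsValues K] {x : K} (hx : x ≠ 0) :
    logHeight ![x, x⁻¹] = 2 * logHeight₁ x := by
  have : x • ![x, x⁻¹] = ![x ^ 2, 1] := by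
    ext i; fin_cases i <;> simp [hx, pow_two]
  rw [← logHeight_smul_eq_logHeight _ hx, this, ← logHeight₁_eq_logHeight, logHeight₁_pow]
  norm_num

theorem logHeight₁_unitCoord_le [AdmissibleAbsValues K] (p : K × K) :
    logHeight₁ (unitCoord p) ≤ pairHeight p := by
  unfold unitCoord pairHeight
  split_ifs with h
  · rw [logHeight₁_one]
    exact logHeight_nonneg _
  · push Not at h
    rw [logHeight₁_div_eq_logHeight]

theorem logHeight_one_inv [AdmissibleAbsValues K] (x : K) :
    logHeight ![1, x⁻¹] = logHeight₁ x := by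
  rw [logHeight_swap, ← logHeight₁_eq_logHeight, logHeight₁_inv]

theorem IsCriticalPair.mul_logHeight_le [NumberField K] {a b : K} {p q : K × K}
    (h : IsCriticalPair a b p q) (hab : a * b ≠ 1) (n : ℕ) :
    (n + 2) * (logHeight₁ a + logHeight₁ b) ≤
      2 * (pairHeight ((quadLift a b)^[n + 1] p) + pairHeight ((quadLift a b)^[n + 1] q)) +
        totalWeight K * (4 * (n + 2) * Real.log 4) := by
  set α := unitCoord ((quadLift a b)^[n + 1] p) with hα
  set β := unitCoord ((quadLift a b)^[n + 1] q) with hβ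
  have hα0 : α ≠ 0 := unitCoord_ne_zero _
  have hβ0 : β ≠ 0 := unitCoord_ne_zero _
  have four_ne : (4 : K) ≠ 0 := by norm_num
  have hA : ![1, a⁻¹] ^ (n + 2) ≠ 0 :=
    pow_ne_zero _ fun h ↦ one_ne_zero (congr_fun h 0)
  have hB : ![1, b⁻¹] ^ (n + 2) ≠ 0 :=
    pow_ne_zero _ fun h ↦ one_ne_zero (congr_fun h 0)
  have hα' : ![α, α⁻¹] ≠ 0 := fun h ↦ hα0 (congr_fun h 0)
  have hβ' : ![β, β⁻¹] ≠ 0 := fun h ↦ hβ0 (congr_fun h 0)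
  have hX : (4 : K) ^ (2 * (n + 2)) • (fun i : Fin 2 × Fin 2 ↦
      (![1, a⁻¹] ^ (n + 2)) i.1 * (![1, b⁻¹] ^ (n + 2)) i.2) ≠ 0 := by
    refine smul_ne_zero (pow_ne_zero _ four_ne) ?_
    obtain ⟨i, hi⟩ := Function.ne_iff.mp hA
    obtain ⟨j, hj⟩ := Function.ne_iff.mp hB
    exact Function.ne_iff.mpr ⟨(i, j), mul_ne_zero hi hj⟩
  have hY : (fun i : Fin 2 × Fin 2 ↦ ![α, α⁻¹] i.1 * ![β, β⁻¹] i.2) ≠ 0 :=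
    Function.ne_iff.mpr ⟨(0, 0), mul_ne_zero hα0 hβ0⟩
  have locX (v : AbsoluteValue K ℝ) : ⨆ i : Fin 2 × Fin 2,
      v (((4 : K) ^ (2 * (n + 2)) • (fun i : Fin 2 × Fin 2 ↦
      (![1, a⁻¹] ^ (n + 2)) i.1 * (![1, b⁻¹] ^ (n + 2)) i.2)) i) =
      v 4 ^ (2 * (n + 2)) * (max 1 (v a⁻¹) ^ (n + 2) * max 1 (v b⁻¹) ^ (n + 2)) := by
    simp only [Pi.smul_apply, smul_eq_mul]
    simp_rw [v.map_mul (4 ^ (2 * (n + 2)))]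
    rw [← Real.mul_iSup_of_nonneg (v.nonneg _),
      Real.iSup_fun_mul_eq_iSup_mul_iSup_of_nonneg v, v.iSup_pow, v.iSup_pow, iSup_abv_two,
      iSup_abv_two, v.map_one, map_pow]
  have locY (v : AbsoluteValue K ℝ) : ⨆ i : Fin 2 × Fin 2,
      v (![α, α⁻¹] i.1 * ![β, β⁻¹] i.2) = max (v α) (v α⁻¹) * max (v β) (v β⁻¹) := by
    rw [Real.iSup_fun_mul_eq_iSup_mul_iSup_of_nonneg v, iSup_abv_two, iSup_abv_two]
  have hfour (v : AbsoluteValue K ℝ) : v 4 = v 2 ^ 2 := by rw [← map_pow]; norm_num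
  -- The scalar `4^(2(n+2))` in the left tuple absorbs the loss at dyadic places without changing
  -- the height. At archimedean places it costs as much again as `κ^(2(n+2))`, whence the exponent
  -- `4(n+2)`.
  have main := logHeight_le_of_forall_iSup_le (C := 4 ^ (4 * (n + 2))) hX hY (by positivity)
    (fun v hv ↦ by
      have h2 := abv_two_of_mem_archAbsVal hv
      rw [locX, locY, hfour, h2]
      have key := h.local_bound (v := v) (κ := 4) (c := 1) hab one_pos le_rfl (by norm_num)
        (by norm_num) (contractsNearZero_of_four_mul_lt b) (contractsNearZero_of_four_mul_lt a)
        (by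
          have := v.add_le (p.1 * q.2) (q.1 * p.2)
          rw [h.add_eq, v.map_neg, h2] at this
          by_contra! hcon
          rw [max_lt_iff] at hcon
          linarith) n
      calc _ ≤ ((2 : ℝ) ^ 2) ^ (2 * (n + 2)) * (4 ^ (2 * (n + 2)) *
            (max (v α) (v α⁻¹) * max (v β) (v β⁻¹))) := by gcongr
        _ = _ := by
          rw [← mul_assoc, show (2 : ℝ) ^ 2 = 4 by norm_num, ← pow_add]
          congr 2
          ring)
    (fun v hv ↦ by
      have hna := isNonarchimedean v hv
      have h2 : v 2 ≤ 1 := by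
        have := hna 1 1
        rwa [one_add_one_eq_two, max_self, v.map_one] at this
      have h2pos : 0 < v 2 := v.pos two_ne_zero
      have h4 : 1 ≤ (v 4)⁻¹ := by
        rw [hfour]
        exact (one_le_inv₀ (by positivity)).mpr (pow_le_one₀ h2pos.le h2)
      rw [locX, locY]
      -- The two products sum to `-2`, so the ultrametric inequality gives one of size at least
      -- `|2|`; then `κ = c⁻²` is the least admissible value.
      have key := h.local_bound (v := v) (κ := (v 4)⁻¹) (c := v 2) hab h2pos h2 h4
        (by rw [hfour, inv_mul_cancel₀ (by positivity)])
        (contractsNearZero_of_isNonarchimedean hna b h4)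
        (contractsNearZero_of_isNonarchimedean hna a h4)
        (by
          have := hna (p.1 * q.2) (q.1 * p.2)
          rwa [h.add_eq, v.map_neg] at this) n
      have h4pos : 0 < v 4 := v.pos four_ne
      rwa [inv_pow, ← div_eq_inv_mul, le_div_iff₀ (by positivity), mul_comm] at key)
  have hu := logHeight₁_unitCoord_le ((quadLift a b)^[n + 1] p)
  have hw := logHeight₁_unitCoord_le ((quadLift a b)^[n + 1] q)
  rw [← hα] at hu
  rw [← hβ] at hw
  rw [logHeight_smul_eq_logHeight _ (pow_ne_zero _ four_ne), logHeight_fun_mul_eq hA hB,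
    logHeight_fun_mul_eq hα' hβ', logHeight_pow, logHeight_pow, logHeight_one_inv,
    logHeight_one_inv, logHeight_self_inv hα0, logHeight_self_inv hβ0, Real.log_pow] at main
  push_cast at main
  linarith

theorem Height.logHeight_one_pair_le [AdmissibleAbsValues K] (a b : K) :
    logHeight ![1, a, b] ≤ logHeight₁ a + logHeight₁ b := by
  have hA : ![a, 1] ≠ 0 := fun h ↦ one_ne_zero (congr_fun h 1)
  have hB : ![b, 1] ≠ 0 := fun h ↦ one_ne_zero (congr_fun h 1)
  rw [logHeight₁_eq_logHeight, logHeight₁_eq_logHeight, ← logHeight_fun_mul_eq hA hB]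
  have : ![1, a, b] = (fun i : Fin 2 × Fin 2 ↦ ![a, 1] i.1 * ![b, 1] i.2) ∘
      ![(1, 1), (0, 1), (1, 0)] := by
    ext i; fin_cases i <;> simp
  rw [this]
  exact logHeight_comp_le _ _

end GlobalBound

/-! ### The quadratic map on the projective line -/

section ProjectiveLine

variable {K : Type*} [Field K]

/-- The point of the projective line `K ∪ {∞}` with given homogeneous coordinates. -/
def projPoint (p : K × K) : OnePoint K :=
  open Classical in if p.2 = 0 then OnePoint.infty else ((p.1 / p.2 : K) : OnePoint K)

theorem projPoint_of_snd_eq_zero {p : K × K} (h : p.2 = 0) : projPoint p = OnePoint.infty :=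
  if_pos h

theorem projPoint_of_snd_ne_zero {p : K × K} (h : p.2 ≠ 0) :
    projPoint p = ((p.1 / p.2 : K) : OnePoint K) :=
  if_neg h

theorem projPoint_eq_infty_iff {p : K × K} : projPoint p = OnePoint.infty ↔ p.2 = 0 := by
  unfold projPoint
  split_ifs with h <;> simp [h]

theorem projPoint_eq_coe_iff {p : K × K} (hp : p ≠ 0) {z : K} :
    projPoint p = (z : OnePoint K) ↔ p.2 * z - p.1 = 0 := by
  unfold projPoint
  split_ifs with h
  · have h1 : p.1 ≠ 0 := fun h1 ↦ hp (Prod.ext h1 h)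
    simp [h, h1]
  · rw [OnePoint.coe_eq_coe, div_eq_iff h, sub_eq_zero, mul_comm, eq_comm]

end ProjectiveLine

/-! ### Degree, action and ramification of the quadratic map. -/

section QuadraticMap

variable {a b : QBar}

theorem exists_num_denom_quadraticMap (hab : a * b ≠ 1) :
    ∃ u : QBar, u ≠ 0 ∧ (quadraticMap a b).num = C u * (C a * X + X ^ 2) ∧
      (quadraticMap a b).denom = C u * (C b * X + 1) := by
  set p : QBar[X] := C a * X + X ^ 2
  set q : QBar[X] := C b * X + 1
  have hq : q ≠ 0 := by
    intro h
    have := congr_arg (eval 0) h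
    simp [q] at this
  have hf : quadraticMap a b = algebraMap _ _ p / algebraMap _ _ q := by
    simp [quadraticMap, p, q, RatFunc.algebraMap_C, RatFunc.algebraMap_X]
  have hr : 1 - a * b ≠ 0 := sub_ne_zero.mpr hab.symm
  -- Coprimality, with a Bézout relation divided by the resultant, shows that the fraction is
  -- reduced; `u` accounts for the normalisation of `num` and `denom`.
  have hcop : IsCoprime q p := by
    refine ⟨C (1 - a * b)⁻¹ * (1 - C b * X - C (a * b)), C (1 - a * b)⁻¹ * C (b ^ 2), ?_⟩
    have h1 : (C (1 - a * b)⁻¹ : QBar[X]) * (1 - C a * C b) = 1 := by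
      rw [← C_1, ← C_mul, ← C_sub, ← C_mul, inv_mul_cancel₀ hr]
    simp only [p, q, C_mul, C_pow]
    linear_combination h1
  have hcross : (quadraticMap a b).num * q = p * (quadraticMap a b).denom := by
    have h := RatFunc.num_div_denom (quadraticMap a b)
    nth_rw 3 [hf] at h
    rw [div_eq_div_iff (RatFunc.algebraMap_ne_zero (RatFunc.denom_ne_zero _))
      (RatFunc.algebraMap_ne_zero hq), ← map_mul, ← map_mul] at h
    exact RatFunc.algebraMap_injective _ h
  have hd1 : (quadraticMap a b).denom ∣ q := by rw [hf]; exact RatFunc.denom_div_dvd p q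
  have hd2 : q ∣ (quadraticMap a b).denom :=
    hcop.dvd_of_dvd_mul_left (Dvd.intro_left _ hcross)
  obtain ⟨w, hw⟩ := associated_of_dvd_dvd hd2 hd1
  obtain ⟨u, hu, huw⟩ := Polynomial.isUnit_iff.mp w.isUnit
  refine ⟨u, hu.ne_zero, ?_, ?_⟩
  · refine mul_right_cancel₀ hq ?_
    rw [hcross, ← hw, ← huw]
    ring
  · rw [← hw, ← huw, mul_comm]

theorem ratDegree_quadraticMap (hab : a * b ≠ 1) : ratDegree (quadraticMap a b) = 2 := by
  obtain ⟨u, hu, hn, hd⟩ := exists_num_denom_quadraticMap hab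
  have h1 : (quadraticMap a b).num.natDegree = 2 := by
    rw [hn, natDegree_C_mul hu]
    compute_degree!
  have h2 : (quadraticMap a b).denom.natDegree ≤ 1 := by
    rw [hd, natDegree_C_mul hu]
    compute_degree
  rw [ratDegree, h1]
  exact max_eq_left (h2.trans one_le_two)

theorem denom_coeff_two (hab : a * b ≠ 1) : (quadraticMap a b).denom.coeff 2 = 0 := by
  obtain ⟨u, -, -, hd⟩ := exists_num_denom_quadraticMap hab
  rw [hd]
  simp [coeff_one]

open Classical in
theorem ratMap_quadraticMap_infty (hab : a * b ≠ 1) :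
    ratMap (quadraticMap a b) OnePoint.infty = OnePoint.infty := by
  change ite _ _ _ = _
  rw [if_pos]
  rw [ratDegree_quadraticMap hab, denom_coeff_two hab]

open Classical in
theorem ratMap_quadraticMap_coe (hab : a * b ≠ 1) (z : QBar) :
    ratMap (quadraticMap a b) (z : OnePoint QBar) =
      projPoint (z * (z + a), b * z + 1) := by
  obtain ⟨u, hu, hn, hd⟩ := exists_num_denom_quadraticMap hab
  change ite _ _ _ = ite _ _ _
  simp only [hn, hd, eval_mul, eval_add, eval_C, eval_X, eval_pow, eval_one,
    mul_eq_zero, hu, false_or, mul_div_mul_left _ _ hu]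
  congr 3
  ring

theorem ratMap_quadraticMap (hab : a * b ≠ 1) (p : QBar × QBar) :
    ratMap (quadraticMap a b) (projPoint p) = projPoint (quadLift a b p) := by
  by_cases h : p.2 = 0
  · rw [projPoint_of_snd_eq_zero h, ratMap_quadraticMap_infty hab, projPoint_of_snd_eq_zero]
    simp [quadLift, h]
  · rw [projPoint_of_snd_ne_zero h, ratMap_quadraticMap_coe hab]
    have h1 : b * (p.1 / p.2) + 1 = (b * p.1 + p.2) / p.2 := by field_simp
    by_cases h2 : b * p.1 + p.2 = 0
    · rw [projPoint_of_snd_eq_zero, projPoint_of_snd_eq_zero]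
      · simp [quadLift, h2]
      · simp [h1, h2]
    · rw [projPoint_of_snd_ne_zero, projPoint_of_snd_ne_zero]
      · simp only [quadLift, h1]
        congr 1
        field_simp
      · simp [quadLift, h, h2]
      · simp [h1, h, h2]

theorem ratMap_quadraticMap_iterate (hab : a * b ≠ 1) (p : QBar × QBar) (n : ℕ) :
    (ratMap (quadraticMap a b))^[n] (projPoint p) = projPoint ((quadLift a b)^[n] p) := by
  induction n with
  | zero => rfl
  | succ n ih =>
    rw [Function.iterate_succ_apply', Function.iterate_succ_apply', ih, ratMap_quadraticMap hab]

open Classical in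
theorem ramificationIndex_infty (hab : a * b ≠ 1) :
    ramificationIndex (quadraticMap a b) OnePoint.infty = if b = 0 then 2 else 1 := by
  change ratDegree _ - (fiberPoly _ (ratMap _ OnePoint.infty)).natDegree = _
  rw [ratMap_quadraticMap_infty hab, ratDegree_quadraticMap hab]
  change 2 - (quadraticMap a b).denom.natDegree = _
  obtain ⟨u, hu, -, hd⟩ := exists_num_denom_quadraticMap hab
  rw [hd, natDegree_C_mul hu]
  split_ifs with hb
  · simp [hb]
  · have : (C b * X + 1 : QBar[X]).natDegree = 1 := by compute_degree!
    rw [this]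

/-- Ramification is a double root of the fibre polynomial. Away from the pole, its derivative times
`b z + 1` equals a unit times the critical form, by the fibre equation; at the pole both are
nonzero. -/
theorem fiberPoly_quadraticMap (hab : a * b ≠ 1) (z : QBar) :
    fiberPoly (quadraticMap a b) (ratMap (quadraticMap a b) z) ≠ 0 ∧
    (fiberPoly (quadraticMap a b) (ratMap (quadraticMap a b) z)).IsRoot z ∧
    ((derivative (fiberPoly (quadraticMap a b) (ratMap (quadraticMap a b) z))).IsRoot z ↔
      b * z ^ 2 + 2 * z + a = 0) := by
  obtain ⟨u, hu, hn, hd⟩ := exists_num_denom_quadraticMap hab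
  rw [ratMap_quadraticMap_coe hab]
  by_cases h : b * z + 1 = 0
  · rw [projPoint_of_snd_eq_zero h]
    change (quadraticMap a b).denom ≠ 0 ∧ (quadraticMap a b).denom.IsRoot z ∧
      ((derivative (quadraticMap a b).denom).IsRoot z ↔ _)
    refine ⟨RatFunc.denom_ne_zero _, by simp [hd, h], ?_⟩
    have hb : b ≠ 0 := by rintro rfl; simp at h
    have hz : b * (b * z ^ 2 + 2 * z + a) = a * b - 1 := by linear_combination (b * z + 1) * h
    have hne : b * z ^ 2 + 2 * z + a ≠ 0 := by
      intro h0
      rw [h0, mul_zero] at hz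
      exact hab (sub_eq_zero.mp hz.symm)
    simp [hd, hu, hb, hne]
  · rw [projPoint_of_snd_ne_zero h]
    set w := z * (z + a) / (b * z + 1) with hw
    have hwz : w * (b * z + 1) = z * (z + a) := div_mul_cancel₀ _ h
    change (quadraticMap a b).num - C w * (quadraticMap a b).denom ≠ 0 ∧
      ((quadraticMap a b).num - C w * (quadraticMap a b).denom).IsRoot z ∧
      ((derivative ((quadraticMap a b).num - C w * (quadraticMap a b).denom)).IsRoot z ↔ _)
    have heq : (quadraticMap a b).num - C w * (quadraticMap a b).denom =
        C u * (X ^ 2 + C (a - w * b) * X - C w) := by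
      rw [hn, hd]
      simp only [C_sub, C_mul]
      ring
    rw [heq]
    refine ⟨?_, ?_, ?_⟩
    · refine mul_ne_zero (C_ne_zero.mpr hu) fun h0 ↦ ?_
      have := congr_arg (coeff · 2) h0
      simp at this
    · simp only [IsRoot.def, eval_mul, eval_C, eval_add, eval_sub, eval_pow, eval_X]
      linear_combination -u * hwz
    · have hder : eval z (derivative (C u * (X ^ 2 + C (a - w * b) * X - C w))) * (b * z + 1) =
          u * (b * z ^ 2 + 2 * z + a) := by
        simp
        linear_combination -u * b * hwz
      rw [IsRoot.def, ← mul_eq_zero_iff_right h, hder, mul_eq_zero, or_iff_right hu]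

theorem ramificationIndex_coe_eq_one (hab : a * b ≠ 1) {z : QBar}
    (hz : b * z ^ 2 + 2 * z + a ≠ 0) :
    ramificationIndex (quadraticMap a b) (z : OnePoint QBar) = 1 := by
  obtain ⟨h0, h1, h2⟩ := fiberPoly_quadraticMap hab z
  change rootMultiplicity z _ = 1
  have h3 := (rootMultiplicity_pos h0).mpr h1
  have h4 := (one_lt_rootMultiplicity_iff_isRoot (t := z) h0).not.mpr fun h ↦ hz (h2.mp h.2)
  omega

theorem two_le_ramificationIndex_coe (hab : a * b ≠ 1) {z : QBar}
    (hz : b * z ^ 2 + 2 * z + a = 0) :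
    2 ≤ ramificationIndex (quadraticMap a b) (z : OnePoint QBar) := by
  obtain ⟨h0, h1, h2⟩ := fiberPoly_quadraticMap hab z
  exact (one_lt_rootMultiplicity_iff_isRoot (t := z) h0).mpr ⟨h1, h2.mpr hz⟩

theorem IsCriticalPair.form_eq {K : Type*} [Field K] {a b : K} {p q : K × K}
    (h : IsCriticalPair a b p q) (z : K) :
    b * z ^ 2 + 2 * z + a = (p.2 * z - p.1) * (q.2 * z - q.1) := by
  obtain ⟨h1, h2, h3⟩ := h
  rw [← h1, ← h2]
  linear_combination z * h3

theorem IsCriticalPair.ne_zero {K : Type*} [Field K] [CharZero K] {a b : K} {p q : K × K}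
    (h : IsCriticalPair a b p q) : p ≠ 0 := by
  rintro rfl
  have := h.add_eq
  simp at this

theorem IsCriticalPair.two_le_ramificationIndex {p q : QBar × QBar} (h : IsCriticalPair a b p q)
    (hab : a * b ≠ 1) : 2 ≤ ramificationIndex (quadraticMap a b) (projPoint p) := by
  by_cases hp : p.2 = 0
  · rw [projPoint_of_snd_eq_zero hp, ramificationIndex_infty hab, if_pos]
    rw [← h.snd_mul_snd, hp, zero_mul]
  · rw [projPoint_of_snd_ne_zero hp]
    refine two_le_ramificationIndex_coe hab ?_
    rw [h.form_eq, mul_div_cancel₀ _ hp, sub_self, zero_mul]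

theorem IsCriticalPair.ramificationIndex_eq_one {p q : QBar × QBar} (h : IsCriticalPair a b p q)
    (hab : a * b ≠ 1) {P : OnePoint QBar} (h1 : projPoint p ≠ P) (h2 : projPoint q ≠ P) :
    ramificationIndex (quadraticMap a b) P = 1 := by
  induction P using OnePoint.rec with
  | infty =>
    rw [Ne, projPoint_eq_infty_iff] at h1 h2
    rw [ramificationIndex_infty hab, if_neg]
    rw [← h.snd_mul_snd]
    exact mul_ne_zero h1 h2
  | coe z =>
    rw [Ne, projPoint_eq_coe_iff h.ne_zero] at h1
    rw [Ne, projPoint_eq_coe_iff h.symm.ne_zero] at h2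
    refine ramificationIndex_coe_eq_one hab ?_
    rw [h.form_eq]
    exact mul_ne_zero h1 h2

theorem IsCriticalPair.projPoint_ne {p q : QBar × QBar} (h : IsCriticalPair a b p q)
    (hab : a * b ≠ 1) : projPoint p ≠ projPoint q := by
  have hne : p.1 * q.2 ≠ q.1 * p.2 := by
    intro h0
    have h1 := h.add_eq
    have h2 := h.sq_eq
    have h3 : q.1 * p.2 = -1 := by linear_combination (h1 - h0) / 2
    rw [h3] at h2
    exact hab (by linear_combination h2)
  intro heq
  by_cases hp : p.2 = 0
  · have hq := projPoint_eq_infty_iff.mp (heq ▸ projPoint_of_snd_eq_zero hp)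
    exact hne (by rw [hp, hq]; ring)
  · rw [projPoint_of_snd_ne_zero hp] at heq
    have := (projPoint_eq_coe_iff h.symm.ne_zero).mp heq.symm
    refine hne ?_
    field_simp at this
    linear_combination this

theorem IsCriticalPair.add_le_criticalHeight {p q : QBar × QBar} (h : IsCriticalPair a b p q)
    (hab : a * b ≠ 1) (hp : 0 ≤ canonicalHeight (quadraticMap a b) (projPoint p))
    (hq : 0 ≤ canonicalHeight (quadraticMap a b) (projPoint q)) :
    canonicalHeight (quadraticMap a b) (projPoint p) +
      canonicalHeight (quadraticMap a b) (projPoint q) ≤ criticalHeight (quadraticMap a b) := by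
  classical
  unfold criticalHeight
  -- Finite support matters: `finsum` takes the value `0` on infinite support.
  rw [finsum_eq_sum_of_support_subset (s := {projPoint p, projPoint q}),
    Finset.sum_pair (h.projPoint_ne hab)]
  · have e1 : (2 : ℝ) ≤ ramificationIndex (quadraticMap a b) (projPoint p) := by
      exact_mod_cast h.two_le_ramificationIndex hab
    have e2 : (2 : ℝ) ≤ ramificationIndex (quadraticMap a b) (projPoint q) := by
      exact_mod_cast h.symm.two_le_ramificationIndex hab
    nlinarith
  · intro P hP
    contrapose! hP
    simp only [Finset.coe_insert, Finset.coe_singleton, Set.mem_insert_iff,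
      Set.mem_singleton_iff, not_or] at hP
    simp [h.ramificationIndex_eq_one hab (Ne.symm hP.1) (Ne.symm hP.2)]

end QuadraticMap

/-! ### Canonical heights along an orbit -/

/-- If `u (n + 1)` differs from `2 u n` by a bounded amount, then `u n / 2 ^ n` converges, and its
limit controls every `u m`. -/
theorem exists_tendsto_div_two_pow {u : ℕ → ℝ} {C D : ℝ}
    (hC : ∀ n, u (n + 1) ≤ 2 * u n + C) (hD : ∀ n, 2 * u n ≤ u (n + 1) + D) :
    ∃ l, Tendsto (fun n ↦ u n / 2 ^ n) atTop (𝓝 l) ∧ ∀ m, u m ≤ 2 ^ m * l + D := by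
  have hcau : CauchySeq fun n ↦ u n / 2 ^ n := by
    refine cauchySeq_of_le_geometric_two (C := max C D) fun n ↦ ?_
    have h2 : (0 : ℝ) < 2 ^ n := by positivity
    have heq : u n / 2 ^ n - u (n + 1) / 2 ^ (n + 1) = (2 * u n - u (n + 1)) / 2 / 2 ^ n := by
      rw [pow_succ]; field_simp
    rw [Real.dist_eq, heq, abs_div, abs_div, abs_of_pos h2, abs_of_pos (two_pos (α := ℝ))]
    gcongr
    rw [abs_le]
    constructor
    · linarith [hC n, le_max_left C D]
    · linarith [hD n, le_max_right C D]
  obtain ⟨l, hl⟩ := cauchySeq_tendsto_of_complete hcau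
  refine ⟨l, hl, fun m ↦ ?_⟩
  -- The lower recursion says that `u - D` at least doubles at each step; dividing by `2 ^ (m + k)`
  -- and letting `k` grow bounds `l` from below.
  have hlow (k : ℕ) : 2 ^ k * (u m - D) + D ≤ u (m + k) := by
    induction k with
    | zero => simp
    | succ k ih =>
      rw [pow_succ, ← add_assoc]
      linarith [hD (m + k)]
  have hD0 (k : ℕ) : (u m - D) / 2 ^ m + D / 2 ^ (m + k) ≤ u (m + k) / 2 ^ (m + k) := by
    rw [le_div_iff₀ (by positivity), pow_add, add_mul]
    refine (le_of_eq ?_).trans (hlow k)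
    field_simp
  have hz : Tendsto (fun k ↦ (u m - D) / 2 ^ m + D / 2 ^ (m + k)) atTop
      (𝓝 ((u m - D) / 2 ^ m + 0)) := by
    refine tendsto_const_nhds.add ?_
    refine tendsto_const_nhds.div_atTop ?_
    exact (tendsto_pow_atTop_atTop_of_one_lt one_lt_two).comp
      (tendsto_atTop_mono (fun k ↦ Nat.le_add_left k m) tendsto_id)
  have hl' : Tendsto (fun k ↦ u (m + k) / 2 ^ (m + k)) atTop (𝓝 l) :=
    hl.comp (tendsto_atTop_mono (fun k ↦ Nat.le_add_left k m) tendsto_id)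
  have := le_of_tendsto_of_tendsto' hz hl' hD0
  rw [add_zero, div_le_iff₀ (by positivity)] at this
  linarith

/-! ### Passage to absolute heights over a number field containing the critical points. -/

section NumberFieldPoints

variable {L : IntermediateField ℚ QBar}

/-- The point of the projective line over `QBar` with homogeneous coordinates in `L`. -/
def algPoint (p : L × L) : QBar × QBar := (p.1, p.2)

theorem quadLift_iterate_algPoint (a b : L) (p : L × L) (n : ℕ) :
    (quadLift (a : QBar) b)^[n] (algPoint p) = algPoint ((quadLift a b)^[n] p) := by
  induction n with
  | zero => rfl
  | succ n ih =>
    rw [Function.iterate_succ_apply', Function.iterate_succ_apply', ih]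
    simp [quadLift, algPoint]

theorem exists_isCriticalPair {a b s : L} (hs : s ^ 2 = 1 - a * b) :
    ∃ p q : L × L, IsCriticalPair a b p q := by
  by_cases hb : b = 0
  · exact ⟨(1, 0), (a, -2), by simp, by simp [hb], by simp⟩
  · refine ⟨(s - 1, b), ((-s - 1) / b, 1), ?_, by simp, ?_⟩
    · change (s - 1) * ((-s - 1) / b) = a
      field_simp
      linear_combination -hs
    · change (s - 1) * 1 + (-s - 1) / b * b = -2
      field_simp
      ring

variable [NumberField L]

theorem heightP1_projPoint {p : L × L} (hp : p ≠ 0) :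
    heightP1 (projPoint (algPoint p)) = pairHeight p / Module.finrank ℚ L := by
  obtain ⟨x, y⟩ := p
  by_cases hy : y = 0
  · subst hy
    have hx : x ≠ 0 := fun hx ↦ hp (Prod.ext hx rfl)
    rw [projPoint_of_snd_eq_zero (by simp [algPoint])]
    change absLogHeight ![(1 : QBar), 0] = _
    have h1 : ![(1 : QBar), 0] = fun i ↦ ((![1, 0] i : L) : QBar) := by
      ext i; fin_cases i <;> simp
    have h2 : ![x, 0] = x • ![1, 0] := by ext i; fin_cases i <;> simp
    rw [h1, absLogHeight_coe, pairHeight, h2, Height.logHeight_smul_eq_logHeight _ hx]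
  · rw [projPoint_of_snd_ne_zero (by simpa [algPoint] using hy)]
    change absLogHeight ![(x : QBar) / (y : QBar), 1] = _
    have h1 : ![(x : QBar) / (y : QBar), 1] = fun i ↦ ((![x / y, 1] i : L) : QBar) := by
      ext i; fin_cases i <;> simp
    rw [h1, absLogHeight_coe, pairHeight, ← Height.logHeight₁_eq_logHeight,
      Height.logHeight₁_div_eq_logHeight]

theorem canonicalHeight_bounds {a b : L} (hab : a * b ≠ 1) {p : L × L} (hp : p ≠ 0) :
    0 ≤ canonicalHeight (quadraticMap a b) (projPoint (algPoint p)) ∧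
    ∀ m : ℕ, pairHeight ((quadLift a b)^[m] p) / Module.finrank ℚ L ≤
      2 ^ m * canonicalHeight (quadraticMap a b) (projPoint (algPoint p)) +
        (2 * absLogHeight ![1, (a : QBar), (b : QBar)] + Real.log 4) := by
  have hab' : (a : QBar) * b ≠ 1 := by exact_mod_cast hab
  have hd : (0 : ℝ) < Module.finrank ℚ L := by exact_mod_cast Module.finrank_pos
  have hH : absLogHeight ![1, (a : QBar), (b : QBar)] =
      Height.logHeight ![1, a, b] / Module.finrank ℚ L := by
    rw [← absLogHeight_coe]
    congr 1
    ext i; fin_cases i <;> simp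
  set u : ℕ → ℝ := fun n ↦ pairHeight ((quadLift a b)^[n] p) / Module.finrank ℚ L with hu
  have horb (n : ℕ) : heightP1 ((ratMap (quadraticMap (a : QBar) b))^[n]
      (projPoint (algPoint p))) = u n := by
    rw [ratMap_quadraticMap_iterate hab', quadLift_iterate_algPoint,
      heightP1_projPoint (quadLift_iterate_ne_zero hab hp n)]
  have hdef : canonicalHeight (quadraticMap (a : QBar) b) (projPoint (algPoint p)) =
      limUnder atTop (fun n ↦ u n / 2 ^ n) := by
    unfold canonicalHeight
    simp only [horb, ratDegree_quadraticMap hab']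
    rfl
  obtain ⟨l, hl, hbd⟩ := exists_tendsto_div_two_pow (u := u)
    (C := absLogHeight ![1, (a : QBar), (b : QBar)] + Real.log 2)
    (D := 2 * absLogHeight ![1, (a : QBar), (b : QBar)] + Real.log 4)
    (fun n ↦ by
      have := pairHeight_quadLift_le hab (quadLift_iterate_ne_zero hab hp n)
      rw [← Function.iterate_succ_apply' (quadLift a b), NumberField.totalWeight_eq_finrank] at this
      rw [hH]
      simp only [hu]
      field_simp
      linarith)
    (fun n ↦ by
      have := two_mul_pairHeight_le hab (quadLift_iterate_ne_zero hab hp n)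
      rw [← Function.iterate_succ_apply' (quadLift a b), NumberField.totalWeight_eq_finrank] at this
      rw [hH]
      simp only [hu]
      field_simp
      linarith)
  rw [hdef, hl.limUnder_eq]
  refine ⟨ge_of_tendsto' hl fun n ↦ ?_, hbd⟩
  exact div_nonneg (div_nonneg (Height.logHeight_nonneg _) hd.le) (by positivity)

theorem le_criticalHeight_of_sq {a b s : L} (hs : s ^ 2 = 1 - a * b) (hab : a * b ≠ 1) :
    5 * absLogHeight ![1, (a : QBar), (b : QBar)] - 56 * Real.log 4 ≤
      8192 * criticalHeight (quadraticMap a b) := by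
  obtain ⟨p, q, hpq⟩ := exists_isCriticalPair hs
  have hab' : (a : QBar) * b ≠ 1 := by exact_mod_cast hab
  have hd : (0 : ℝ) < Module.finrank ℚ L := by exact_mod_cast Module.finrank_pos
  have hH : absLogHeight ![1, (a : QBar), (b : QBar)] =
      Height.logHeight ![1, a, b] / Module.finrank ℚ L := by
    rw [← absLogHeight_coe]
    congr 1
    ext i; fin_cases i <;> simp
  have hpq' : IsCriticalPair (a : QBar) b (algPoint p) (algPoint q) := by
    refine ⟨?_, ?_, ?_⟩
    · simpa [algPoint] using congr_arg (algebraMap L QBar) hpq.fst_mul_fst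
    · simpa [algPoint] using congr_arg (algebraMap L QBar) hpq.snd_mul_snd
    · have h2 : ((2 : L) : QBar) = 2 := rfl
      simpa [algPoint, h2] using congr_arg (algebraMap L QBar) hpq.add_eq
  obtain ⟨hp0, hp⟩ := canonicalHeight_bounds hab hpq.ne_zero
  obtain ⟨hq0, hq⟩ := canonicalHeight_bounds hab hpq.symm.ne_zero
  have hcrit := hpq'.add_le_criticalHeight hab' hp0 hq0
  -- With index `n` the outcome is slope `(n - 6) / 2^(n+2)` and error `4(n + 3) log 4 / 2^(n+2)`.
  -- The value `n = 11` gives `5/8192` and `56 log 4 / 8192`; `10` makes the error too large and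
  -- `12` the slope too small.
  have hlow := hpq.mul_logHeight_le hab 11
  have hsum := Height.logHeight_one_pair_le a b
  specialize hp 12
  specialize hq 12
  rw [NumberField.totalWeight_eq_finrank, show 11 + 1 = 12 from rfl] at hlow
  push_cast at hlow
  have hlow' : 13 * absLogHeight ![1, (a : QBar), (b : QBar)] ≤
      2 * (pairHeight ((quadLift a b)^[12] p) / Module.finrank ℚ L +
        pairHeight ((quadLift a b)^[12] q) / Module.finrank ℚ L) + 52 * Real.log 4 := by
    rw [hH]
    field_simp
    linarith
  linarith

end NumberFieldPoints

end

theorem theorem4 (lam₀ lamInf : QBar) (hlam : lam₀ * lamInf ≠ 1) :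
    criticalHeight (quadraticMap lam₀ lamInf) ≥
      (1 / 2048 : ℝ) * absLogHeight ![1, lam₀, lamInf] - 0.012 := by
  -- `s` is a square root of a quarter of the discriminant of `b z² + 2 z + a`; adjoining it makes
  -- the critical points rational.
  obtain ⟨s, hs⟩ := IsAlgClosed.exists_pow_nat_eq (1 - lam₀ * lamInf) two_pos
  set L : IntermediateField ℚ QBar := coordField ![lam₀, lamInf, s]
  have : NumberField L := numberField_coordField _
  let y : Fin 3 → L := coordTuple ![lam₀, lamInf, s]
  have key := le_criticalHeight_of_sq (a := y 0) (b := y 1) (s := y 2)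
    (Subtype.ext hs) (fun h ↦ hlam (congr_arg Subtype.val h))
  change 5 * absLogHeight ![1, lam₀, lamInf] - _ ≤ 8192 * criticalHeight (quadraticMap _ _) at key
  have : NumberField (coordField ![1, lam₀, lamInf]) := numberField_coordField _
  -- Needed to lower the slope from `5/8192` to `1/2048 = 4/8192`; the error `112 log 2 / 8192` is
  -- below `0.012`.
  have hnonneg : 0 ≤ absLogHeight ![1, lam₀, lamInf] :=
    div_nonneg (Height.logHeight_nonneg _) (Nat.cast_nonneg _)
  have hlog : Real.log 4 = 2 * Real.log 2 := by
    rw [show (4 : ℝ) = 2 ^ 2 by norm_num, Real.log_pow]; norm_num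
  have := Real.log_two_lt_d9
  change criticalHeight (quadraticMap lam₀ lamInf) ≥ _
  change _ ≤ 8192 * criticalHeight (quadraticMap lam₀ lamInf) at key
  norm_num
  linarith
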